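/- Let $f:\mathbb{R}^d\to\mathbb{R}$, and let $\nabla f:\mathbb{R}^d\to\mathbb{R}^d$ be a Borel vector field that is the gradient of $f$ at every point where $f$ is differentiable (so it is the usual gradient when $f$ is differentiable everywhere). Let $L\ge 0$, $\alpha,\beta,L_\xi>0$ and assume, for all $\theta\in\mathbb{R}^d$: 1. (linear growth) $\|\nabla f(\theta)\|\le L(1+\|\theta\|)$; 2. (dissipativity) $\langle\theta,\nabla f(\theta)\rangle\ge\alpha\|\theta\|^2-\beta$; 3. (noise) $(\xi_k)_{k\ge1}$ is an i.i.d. sequence of random fields $\mathbb{R}^d\to\mathbb{R}^d$ on a probability space, jointly measurable in the sense that there are independent $\sigma$-algebras $\mathcal G_k$ such that $(\omega,\theta)\mapsto\xi_k(\omega,\theta)$ is $\mathcal G_k\otimes\mathcal B(\mathbb{R}^d)$-measurable (e.g. $\xi_k(\theta)=G(\theta,Z_k)$ with $G$ measurable and $(Z_k)$ i.i.d.); moreover $\mathbb{E}[\xi_1(\theta)]=0$ and $\mathbb{E}^{1/2}[\|\xi_1(\theta)\|^2]\le L_\xi^{1/2}(1+\|\theta\|)$; and the law of $\xi_1(\theta)$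 decomposes as $\mu_{1,\theta}+\mu_{2,\theta}$ with (nonnegative) measures such that $\mu_{1,\theta}$ has a Lebesgue density $p_\theta$ and $\inf_{\theta\in C}p_\theta(t)>0$ for every bounded $C\subset\mathbb{R}^d$ and every $t\in\mathbb{R}^d$. Let the step size satisfy $$0<\eta<\frac{\alpha-\sqrt{\bigl(\alpha^2-(3L^2+L_\xi)\bigr)\vee 0}}{3L^2+L_\xi},$$ and let $\theta^{(\eta)}_0=\theta_0$, $\theta^{(\eta)}_{k+1}=\theta^{(\eta)}_k-\eta\bigl(\nabla f(\theta^{(\eta)}_k)+\xi_{k+1}(\theta^{(\eta)}_k)\bigr)$ for $k\ge0$. Then: (a) The Markov chain with transition kernel $\theta\mapsto\mathrm{Law}\bigl(\theta-\eta(\nabla f(\theta)+\xi_1(\theta))\bigr)$ has exactly one stationary probability measure $\pi_\eta$, and $\int\|\theta\|^2\,d\pi_\eta<\infty$. (b) There is $\rho\in(0,1)$ and, for every $L_\phi>0$, a constant $\kappa$ (both may depend on $\eta$, on $\nabla f$ and on the law of the noise, but not on $\phi$, $\theta_0$, $k$) such that for every measurable $\phi:\mathbb{R}^d\to\mathbb{R}$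 with $|\phi(\theta)|\le L_\phi(1+\|\theta\|)$ for all $\theta$, every $\theta_0\in\mathbb{R}^d$ and every $k\ge0$, the functions $\phi(\theta^{(\eta)}_k)$ and $\phi$ are integrable with respect to $\mathbb{P}$ and $\pi_\eta$ respectively, and $$\bigl|\mathbb{E}[\phi(\theta^{(\eta)}_k)]-\pi_\eta(\phi)\bigr|\le\kappa\,\rho^k\,(1+\|\theta_0\|^2),\qquad \pi_\eta(\phi)=\int\phi\,d\pi_\eta.$$ -/

import Mathlib

open MeasureTheory ProbabilityTheory

/-- `g` plays the role of `∇f`: a Borel vector field that is the gradient of `f` at every point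
where `f` is differentiable. If `f` is differentiable everywhere, this forces `g = ∇f`. -/
structure IsGradientField {d : ℕ} (f : EuclideanSpace ℝ (Fin d) → ℝ)
    (g : EuclideanSpace ℝ (Fin d) → EuclideanSpace ℝ (Fin d)) : Prop where
  measurable : Measurable g
  hasGradientAt : ∀ θ, DifferentiableAt ℝ f θ → HasGradientAt f (g θ) θ

/-- At most linear growth of a vector field, with constant `L`. -/
def HasLinearGrowth {d : ℕ} (L : ℝ)
    (g : EuclideanSpace ℝ (Fin d) → EuclideanSpace ℝ (Fin d)) : Prop :=
  ∀ θ, ‖g θ‖ ≤ L * (1 + ‖θ‖)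

/-- `(α, β)`-dissipativity of the gradient field. -/
def IsDissipative {d : ℕ} (α β : ℝ)
    (g : EuclideanSpace ℝ (Fin d) → EuclideanSpace ℝ (Fin d)) : Prop :=
  ∀ θ, α * ‖θ‖ ^ 2 - β ≤ inner ℝ θ (g θ)

/-- An i.i.d. sequence of (jointly measurable) random fields on `ℝᵈ`: there are independent
sub-`σ`-algebras `𝓖 k` such that the `k`-th field is jointly measurable with respect to
`𝓖 k ⊗ Borel`, and all fields have the same law on `ℝᵈ → ℝᵈ` (the product `σ`-algebra, that is,
the same finite-dimensional distributions). For example `ξ k ω θ = G θ (Z k ω)` with `G` jointly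
measurable and `Z` an i.i.d. sequence of random elements of any measurable space. Independence of
the families `(ξ k · θ)_θ` alone would not determine the law of a field at a random point. -/
structure IsIIDRandomField {Ω : Type*} [mΩ : MeasurableSpace Ω] (P : Measure Ω) {d : ℕ}
    (ξ : ℕ → Ω → EuclideanSpace ℝ (Fin d) → EuclideanSpace ℝ (Fin d)) : Prop where
  indep : ∃ 𝓖 : ℕ → MeasurableSpace Ω, (∀ k, 𝓖 k ≤ mΩ) ∧ iIndep 𝓖 P ∧
    ∀ k, Measurable[(𝓖 k).prod inferInstance, inferInstance]
      (fun x : Ω × EuclideanSpace ℝ (Fin d) => ξ k x.1 x.2)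
  identDistrib : ∀ k, IdentDistrib (ξ k) (ξ 0) P P

/-- The conditions on the gradient noise. The sequence is indexed from `0`, so that `ξ k` is the
noise `ξ_{k+1}` used in the step from `θ_k` to `θ_{k+1}`. -/
structure IsGradientNoise {Ω : Type*} [MeasurableSpace Ω] (P : Measure Ω) {d : ℕ} (Lξ : ℝ)
    (ξ : ℕ → Ω → EuclideanSpace ℝ (Fin d) → EuclideanSpace ℝ (Fin d)) : Prop where
  iid : IsIIDRandomField P ξ
  memLp : ∀ θ, MemLp (fun ω => ξ 0 ω θ) 2 P
  centred : ∀ θ, ∫ ω, ξ 0 ω θ ∂P = 0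
  secondMoment : ∀ θ, √(∫ ω, ‖ξ 0 ω θ‖ ^ 2 ∂P) ≤ √Lξ * (1 + ‖θ‖)
  density : ∃ (p : EuclideanSpace ℝ (Fin d) → EuclideanSpace ℝ (Fin d) → ENNReal)
      (μ₂ : EuclideanSpace ℝ (Fin d) → Measure (EuclideanSpace ℝ (Fin d))),
    (∀ θ, Measurable (p θ)) ∧
    (∀ θ, P.map (fun ω => ξ 0 ω θ) = volume.withDensity (p θ) + μ₂ θ) ∧
    ∀ C : Set (EuclideanSpace ℝ (Fin d)), Bornology.IsBounded C → ∀ t, 0 < ⨅ θ ∈ C, p θ t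

/-- The SGD iterates `θ_{k+1} = θ_k - η (g(θ_k) + ξ_{k+1}(θ_k))`, started at `θ₀`. -/
def sgdIterate {Ω : Type*} {d : ℕ} (g : EuclideanSpace ℝ (Fin d) → EuclideanSpace ℝ (Fin d))
    (ξ : ℕ → Ω → EuclideanSpace ℝ (Fin d) → EuclideanSpace ℝ (Fin d)) (η : ℝ)
    (θ₀ : EuclideanSpace ℝ (Fin d)) : ℕ → Ω → EuclideanSpace ℝ (Fin d)
  | 0, _ => θ₀
  | k + 1, ω => sgdIterate g ξ η θ₀ k ω -
      η • (g (sgdIterate g ξ η θ₀ k ω) + ξ k ω (sgdIterate g ξ η θ₀ k ω))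

/-- The transition kernel of the SGD Markov chain: `θ` is sent to the law of
`θ - η (g(θ) + ξ_1(θ))`. -/
noncomputable def sgdKernel {Ω : Type*} [MeasurableSpace Ω] (P : Measure Ω) {d : ℕ}
    (g : EuclideanSpace ℝ (Fin d) → EuclideanSpace ℝ (Fin d))
    (ξ : ℕ → Ω → EuclideanSpace ℝ (Fin d) → EuclideanSpace ℝ (Fin d)) (η : ℝ) :
    Kernel (EuclideanSpace ℝ (Fin d)) (EuclideanSpace ℝ (Fin d)) :=
  (Kernel.id ×ₖ Kernel.const (EuclideanSpace ℝ (Fin d)) P).map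
    (fun x : EuclideanSpace ℝ (Fin d) × Ω => x.1 - η • (g x.1 + ξ 0 x.2 x.1))

/-- The kernel is the announced one. -/
theorem sgdKernel_apply {Ω : Type*} [MeasurableSpace Ω] (P : Measure Ω) [IsProbabilityMeasure P]
    {d : ℕ} {g : EuclideanSpace ℝ (Fin d) → EuclideanSpace ℝ (Fin d)}
    {ξ : ℕ → Ω → EuclideanSpace ℝ (Fin d) → EuclideanSpace ℝ (Fin d)} (η : ℝ)
    (hg : Measurable g)
    (hξ : Measurable (fun x : Ω × EuclideanSpace ℝ (Fin d) => ξ 0 x.1 x.2))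
    (θ : EuclideanSpace ℝ (Fin d)) :
    sgdKernel P g ξ η θ = P.map (fun ω => θ - η • (g θ + ξ 0 ω θ)) := by
  have hstep : Measurable
      (fun x : EuclideanSpace ℝ (Fin d) × Ω => x.1 - η • (g x.1 + ξ 0 x.2 x.1)) := by
    have h2 : Measurable (fun x : EuclideanSpace ℝ (Fin d) × Ω => ξ 0 x.2 x.1) :=
      hξ.comp measurable_swap
    have h1 : Measurable (fun x : EuclideanSpace ℝ (Fin d) × Ω => g x.1) :=
      hg.comp measurable_fst
    exact measurable_fst.sub ((h1.add h2).const_smul η)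
  rw [sgdKernel, Kernel.map_apply _ hstep, Kernel.prod_apply, Kernel.id_apply,
    Kernel.const_apply, Measure.dirac_prod, Measure.map_map hstep measurable_prodMk_left]
  rfl

/-! The theorem is Harris' ergodic theorem with Lyapunov function `‖θ‖ ^ 2`, so a drift and a
minorization have to be established.

Drift: when the square of one step is expanded, dissipativity gains `2ηα‖θ‖²`, centring kills the
cross term with the noise, and the step size bound keeps the second-order terms at half of that
gain, up to lower order in `‖θ‖` (`hasDrift_sgdKernel`).

Minorization: the noise density is bounded below at each `t` uniformly over bounded sets of `θ`, but
not uniformly in `t`, and `g` is only measurable. One step gives translates of a positive measurable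
function, whose infimum may vanish. In two steps, integrating out the intermediate point yields a
convolution, which is positive and continuous in the translation, hence bounded below on compact
sets (`exists_minorization_comp_of_translate_le`).

Together they make the two-step kernel a contraction for a weighted oscillation seminorm
(`HasDrift.exists_contraction`). The laws of the chain are then Cauchy uniformly over measurable
sets, and their limit is the invariant measure (`exists_invariant_of_drift_of_minorization`).
Independence identifies the laws of the iterates with powers of the kernel
(`IsIIDRandomField.map_sgdIterate`). -/

/-! ### Contraction in a weighted oscillation seminorm -/

/-- Every value of `φ - c W` lies below every value of `φ + c W`, so a constant separates them. -/
theorem exists_center_of_abs_sub_le {X : Type*} [Nonempty X] {φ W : X → ℝ} {c : ℝ}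
    (h : ∀ x y, |φ x - φ y| ≤ c * (W x + W y)) : ∃ s, ∀ x, |φ x - s| ≤ c * W x := by
  have hle : ∀ x y, φ x - c * W x ≤ φ y + c * W y := fun x y => by
    have := (abs_le.1 (h x y)).2
    linarith [mul_add c (W x) (W y)]
  obtain ⟨y₀⟩ := ‹Nonempty X›
  have hbdd : BddAbove (Set.range fun x => φ x - c * W x) :=
    ⟨φ y₀ + c * W y₀, by rintro _ ⟨x, rfl⟩; exact hle x y₀⟩
  have : Nonempty X := ⟨y₀⟩
  refine ⟨⨆ x, (φ x - c * W x), fun x => abs_le.2 ⟨?_, ?_⟩⟩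
  · have := ciSup_le fun z => hle z x
    linarith
  · have := le_ciSup hbdd x
    linarith

theorem MeasureTheory.Integrable.of_abs_sub_le {X : Type*} [MeasurableSpace X] {μ : Measure X}
    {φ W : X → ℝ} {c : ℝ} (hφ : Measurable φ) (hW : Integrable W μ)
    [IsFiniteMeasure μ] {s : ℝ} (h : ∀ x, |φ x - s| ≤ c * W x) : Integrable φ μ := by
  have : Integrable (fun x => φ x - s) μ :=
    (hW.const_mul c).mono' (hφ.sub_const s).aestronglyMeasurable (ae_of_all _ h)
  exact (this.add (integrable_const s)).congr (ae_of_all _ fun x => by simp)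

/-- Both `c W - (φ - s)` and `c W + (φ - s)` are nonnegative, so their integrals over the common
part `ν` are at most those over `μ₁` and `μ₂`. On adding, `φ` cancels over `ν` and the gain `2c ∫ W
dν` remains. -/
theorem integral_sub_integral_le_of_le {X : Type*} [MeasurableSpace X] {μ₁ μ₂ ν : Measure X}
    [IsProbabilityMeasure μ₁] [IsProbabilityMeasure μ₂] (h₁ : ν ≤ μ₁) (h₂ : ν ≤ μ₂)
    {φ W : X → ℝ} {c s : ℝ} (hφ : Measurable φ)
    (h : ∀ x, |φ x - s| ≤ c * W x) (hc : 0 ≤ c) (hW : ∀ x, 1 ≤ W x)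
    (hW₁ : Integrable W μ₁) (hW₂ : Integrable W μ₂) :
    ∫ x, φ x ∂μ₁ - ∫ x, φ x ∂μ₂ ≤
      c * (∫ x, W x ∂μ₁ + ∫ x, W x ∂μ₂ - 2 * ν.real Set.univ) := by
  have : IsFiniteMeasure ν := isFiniteMeasure_of_le μ₁ h₁
  have hψ : ∀ μ : Measure X, [IsFiniteMeasure μ] → Integrable W μ →
      Integrable (fun x => φ x - s) μ := fun μ _ hWμ =>
    (hWμ.const_mul c).mono' (hφ.sub_const s).aestronglyMeasurable (ae_of_all _ h)
  have hWν : Integrable W ν := hW₁.mono_measure h₁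
  have e : ∀ μ : Measure X, [IsProbabilityMeasure μ] → Integrable W μ →
      ∫ x, (φ x - s) ∂μ = ∫ x, φ x ∂μ - s := fun μ _ hWμ => by
    rw [integral_sub (Integrable.of_abs_sub_le hφ hWμ h) (integrable_const s)]; simp
  have k₁ : ∫ x, (c * W x - (φ x - s)) ∂ν ≤ ∫ x, (c * W x - (φ x - s)) ∂μ₁ :=
    integral_mono_measure h₁ (ae_of_all _ fun x => by
      have := (abs_le.1 (h x)).2; simp only [Pi.zero_apply]; linarith)
      ((hW₁.const_mul c).sub (hψ μ₁ hW₁))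
  have k₂ : ∫ x, (c * W x + (φ x - s)) ∂ν ≤ ∫ x, (c * W x + (φ x - s)) ∂μ₂ :=
    integral_mono_measure h₂ (ae_of_all _ fun x => by
      have := (abs_le.1 (h x)).1; simp only [Pi.zero_apply]; linarith)
      ((hW₂.const_mul c).add (hψ μ₂ hW₂))
  rw [integral_sub (hWν.const_mul c) (hψ ν hWν), integral_sub (hW₁.const_mul c) (hψ μ₁ hW₁),
    integral_const_mul, integral_const_mul, e μ₁ hW₁] at k₁
  rw [integral_add (hWν.const_mul c) (hψ ν hWν), integral_add (hW₂.const_mul c) (hψ μ₂ hW₂),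
    integral_const_mul, integral_const_mul, e μ₂ hW₂] at k₂
  have k₃ : ν.real Set.univ ≤ ∫ x, W x ∂ν := by
    have := integral_mono (integrable_const (1 : ℝ)) hWν hW
    simpa using this
  nlinarith [mul_le_mul_of_nonneg_left k₃ hc]

theorem abs_integral_sub_integral_le_of_le {X : Type*} [MeasurableSpace X] {μ₁ μ₂ ν : Measure X}
    [IsProbabilityMeasure μ₁] [IsProbabilityMeasure μ₂] (h₁ : ν ≤ μ₁) (h₂ : ν ≤ μ₂)
    {φ W : X → ℝ} {c s : ℝ} (hφ : Measurable φ)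
    (h : ∀ x, |φ x - s| ≤ c * W x) (hc : 0 ≤ c) (hW : ∀ x, 1 ≤ W x)
    (hW₁ : Integrable W μ₁) (hW₂ : Integrable W μ₂) :
    |∫ x, φ x ∂μ₁ - ∫ x, φ x ∂μ₂| ≤
      c * (∫ x, W x ∂μ₁ + ∫ x, W x ∂μ₂ - 2 * ν.real Set.univ) := by
  have k₁ := integral_sub_integral_le_of_le h₁ h₂ hφ h hc hW hW₁ hW₂
  have k₂ := integral_sub_integral_le_of_le h₂ h₁ hφ h hc hW hW₂ hW₁
  rw [abs_le]
  constructor <;> linarith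

/-- A Foster–Lyapunov drift condition: `V` is a Lyapunov function of the kernel `T`. -/
def HasDrift {X : Type*} [MeasurableSpace X] (T : Kernel X X) (V : X → ℝ) (γ B : ℝ) : Prop :=
  ∀ x, Integrable V (T x) ∧ ∫ y, V y ∂T x ≤ γ * V x + B

/-- The Hairer–Mattingly contraction: drift and minorization on a large sublevel set of `V` make
the kernel a strict contraction for the weighted oscillation seminorm. -/
theorem HasDrift.exists_contraction {X : Type*} [MeasurableSpace X] {T : Kernel X X}
    [IsMarkovKernel T] {V : X → ℝ} (hV0 : ∀ x, 0 ≤ V x) {γ B R : ℝ}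
    (hγ1 : γ < 1) (hB : 0 ≤ B) (hT : HasDrift T V γ B) (hR : 2 * B < (1 - γ) * R)
    {ν : Measure X} [IsFiniteMeasure ν] (hν : ν ≠ 0) (hmin : ∀ x, V x ≤ R → ν ≤ T x) :
    ∃ b : ℝ, 0 < b ∧ ∃ ρ : ℝ, 0 < ρ ∧ ρ < 1 ∧ ∀ (c : ℝ) (φ : X → ℝ), 0 ≤ c → Measurable φ →
      (∀ x y, |φ x - φ y| ≤ c * ((1 + b * V x) + (1 + b * V y))) →
      ∀ x y, |∫ z, φ z ∂T x - ∫ z, φ z ∂T y| ≤ ρ * c * ((1 + b * V x) + (1 + b * V y)) := by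
  set a := ν.real Set.univ with ha
  have ha0 : 0 < a := by
    rw [ha, measureReal_def]
    exact ENNReal.toReal_pos (by simpa using hν) (measure_ne_top _ _)
  -- A small weight: the minorization gain `2a` must absorb the drift cost `2bB` and leave at least
  -- `a`.
  set b := a / (2 * B + 1) with hb
  have hb0 : 0 < b := by positivity
  have hbB : 2 * b * B ≤ a := by
    have : b * (2 * B + 1) = a := by rw [hb]; field_simp
    nlinarith
  set δ := (1 - γ) * R - 2 * B with hδ
  have hδ0 : 0 < δ := by linarith
  have hR0 : 0 < R := by
    by_contra! h
    nlinarith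
  -- The rate for which the drift estimate `2 + b(γS + 2B) ≤ ρ₁(2 + bS)` is an equality at `S = R`;
  -- as `γ ≤ ρ₁`, it persists for `S ≥ R`.
  set ρ₁ := 1 - b * δ / (2 + b * R) with hρ₁
  have hρ₁1 : ρ₁ < 1 := by have : 0 < b * δ / (2 + b * R) := by positivity
                           linarith
  have hρ₁e : (1 - ρ₁) * (2 + b * R) = b * δ := by rw [hρ₁]; field_simp; ring
  have hρ₁γ : 1 - ρ₁ ≤ 1 - γ := by
    have h1 : b * δ ≤ (1 - γ) * (2 + b * R) := by
      have : 0 ≤ b * B := by positivity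
      rw [hδ]; nlinarith
    rw [← hρ₁e] at h1
    exact le_of_mul_le_mul_right h1 (by positivity)
  refine ⟨b, hb0, max (max ρ₁ (1 - a / 2)) (max γ (1 / 2)), ?_, ?_, ?_⟩
  · exact lt_of_lt_of_le (by norm_num) ((le_max_right γ (1 / 2)).trans (le_max_right _ _))
  · refine max_lt (max_lt hρ₁1 (by linarith)) (max_lt hγ1 (by norm_num))
  intro c φ hc hφ hosc x y
  set ρ := max (max ρ₁ (1 - a / 2)) (max γ (1 / 2)) with hρ
  have r1 : ρ₁ ≤ ρ := (le_max_left _ _).trans (le_max_left _ _)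
  have r2 : 1 - a / 2 ≤ ρ := (le_max_right _ _).trans (le_max_left _ _)
  have r3 : γ ≤ ρ := (le_max_left _ _).trans (le_max_right _ _)
  have : Nonempty X := ⟨x⟩
  obtain ⟨s, hs⟩ := exists_center_of_abs_sub_le (W := fun x => 1 + b * V x) hosc
  have hWi : ∀ x, Integrable (fun x => 1 + b * V x) (T x) := fun x =>
    (integrable_const 1).add ((hT x).1.const_mul b)
  have hW1 : ∀ x, 1 ≤ 1 + b * V x := fun x => by
    have := mul_nonneg hb0.le (hV0 x); linarith
  have hWT : ∀ x, ∫ z, (1 + b * V z) ∂T x ≤ 1 + b * (γ * V x + B) := fun x => by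
    rw [integral_add (integrable_const 1) ((hT x).1.const_mul b), integral_const_mul]
    have := mul_le_mul_of_nonneg_left (hT x).2 hb0.le
    simp only [integral_const, probReal_univ, smul_eq_mul, one_mul]; linarith
  set S := V x + V y with hS
  have hS0 : 0 ≤ S := add_nonneg (hV0 x) (hV0 y)
  have hfin : ∀ t : ℝ, |∫ z, φ z ∂T x - ∫ z, φ z ∂T y| ≤ c * t → t ≤ ρ * (2 + b * S) →
      |∫ z, φ z ∂T x - ∫ z, φ z ∂T y| ≤ ρ * c * ((1 + b * V x) + (1 + b * V y)) := by
    intro t h1 h2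
    refine h1.trans ((mul_le_mul_of_nonneg_left h2 hc).trans (le_of_eq ?_))
    rw [hS]; ring
  -- Far out, drift alone contracts and the common part is taken to be `0`. Otherwise both points
  -- lie in the sublevel set, because `V ≥ 0`.
  rcases le_or_gt R S with hRS | hSR
  · have key := abs_integral_sub_integral_le_of_le (Measure.zero_le (T x)) (Measure.zero_le (T y))
      hφ hs hc hW1 (hWi x) (hWi y)
    refine hfin _ key ?_
    have h1 : ρ₁ * (2 + b * S) ≤ ρ * (2 + b * S) :=
      mul_le_mul_of_nonneg_right r1 (by positivity)
    have h2 : (1 - ρ₁) * (b * (S - R)) ≤ (1 - γ) * (b * (S - R)) :=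
      mul_le_mul_of_nonneg_right hρ₁γ (mul_nonneg hb0.le (by linarith))
    have h3 := hWT x
    have h4 := hWT y
    simp only [measureReal_zero, Pi.zero_apply, mul_zero, sub_zero]
    nlinarith
  · have key := abs_integral_sub_integral_le_of_le (hmin x (by linarith [hV0 y]))
      (hmin y (by linarith [hV0 x])) hφ hs hc hW1 (hWi x) (hWi y)
    refine hfin _ key ?_
    have h3 := hWT x
    have h4 := hWT y
    have h5 : γ * (b * S) ≤ ρ * (b * S) := mul_le_mul_of_nonneg_right r3 (by positivity)
    nlinarith

/-! ### Setwise limits of probability measures -/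

open Filter Topology in
/-- A sequence of probability measures that is Cauchy uniformly on measurable sets converges
uniformly on measurable sets. -/
theorem exists_setwise_limit_of_uniform_cauchy {X : Type*} [MeasurableSpace X]
    {μ : ℕ → Measure X} [∀ n, IsProbabilityMeasure (μ n)] {u : ℕ → ℝ}
    (hu : Tendsto u atTop (𝓝 0))
    (h : ∀ n m A, MeasurableSet A → |(μ (n + m)).real A - (μ n).real A| ≤ u n) :
    ∃ π : Measure X, IsProbabilityMeasure π ∧
      ∀ A, MeasurableSet A → Tendsto (fun n => μ n A) atTop (𝓝 (π A)) := by
  have hlim : ∀ A, ∃ l, MeasurableSet A → Tendsto (fun n => (μ n).real A) atTop (𝓝 l) := by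
    intro A
    by_cases hA : MeasurableSet A
    · have hc : CauchySeq fun n => (μ n).real A := by
        refine cauchySeq_of_le_tendsto_0' u (fun n m hnm => ?_) hu
        obtain ⟨k, rfl⟩ := Nat.exists_eq_add_of_le hnm
        rw [dist_comm, Real.dist_eq]
        exact h n k A hA
      obtain ⟨l, hl⟩ := cauchySeq_tendsto_of_complete hc
      exact ⟨l, fun _ => hl⟩
    · exact ⟨0, fun h => absurd h hA⟩
  choose p hp using hlim
  have hp0 : ∀ A, MeasurableSet A → 0 ≤ p A := fun A hA =>
    ge_of_tendsto' (hp A hA) fun n => measureReal_nonneg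
  have hunif : ∀ n A, MeasurableSet A → |p A - (μ n).real A| ≤ u n := fun n A hA => by
    have h1 : Tendsto (fun m => |(μ (n + m)).real A - (μ n).real A|) atTop
        (𝓝 |p A - (μ n).real A|) :=
      (((hp A hA).comp (tendsto_add_atTop_nat n)).congr
        (fun m => by simp [add_comm])).sub_const _ |>.abs
    exact le_of_tendsto' h1 fun m => h n m A hA
  have hsum : ∀ f : ℕ → Set X, (∀ i, MeasurableSet (f i)) → Pairwise (Function.onFun Disjoint f) →
      HasSum (fun i => p (f i)) (p (⋃ i, f i)) := by
    intro f hf hd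
    have hfin : ∀ n (s : Finset ℕ), ∑ i ∈ s, (μ n).real (f i) = (μ n).real (⋃ i ∈ s, f i) :=
      fun n s => (measureReal_biUnion_finset (fun i _ j _ hij => hd hij) (fun i _ => hf i)).symm
    have hpfin : ∀ s : Finset ℕ, ∑ i ∈ s, p (f i) = p (⋃ i ∈ s, f i) := fun s =>
      tendsto_nhds_unique (tendsto_finsetSum s fun i _ => hp _ (hf i))
        ((hp _ (s.measurableSet_biUnion fun i _ => hf i)).congr fun n => (hfin n s).symm)
    -- A finite partial sum is the measure of a finite union, so convergence is uniform over finite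
    -- index sets; this permits the exchange of limits that gives countable additivity.
    have hU : TendstoUniformly (fun n (s : Finset ℕ) => ∑ i ∈ s, (μ n).real (f i))
        (fun s => ∑ i ∈ s, p (f i)) atTop := by
      rw [Metric.tendstoUniformly_iff]
      intro ε hε
      filter_upwards [hu.eventually (gt_mem_nhds hε)] with n hn s
      rw [hfin, hpfin, Real.dist_eq]
      exact (hunif n _ (s.measurableSet_biUnion fun i _ => hf i)).trans_lt hn
    refine hU.tendsto_of_eventually_tendsto (Eventually.of_forall fun n => ?_)
      (hp _ (MeasurableSet.iUnion hf))
    have h1 := (measure_iUnion hd hf (μ := μ n)).symm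
    have h2 : ∑' i, (μ n) (f i) ≠ ⊤ := h1 ▸ measure_ne_top _ _
    have h3 := ENNReal.hasSum_toReal h2
    rwa [← ENNReal.tsum_toReal_eq (fun i => measure_ne_top _ _), h1] at h3
  have hempty : p ∅ = 0 := tendsto_nhds_unique (hp ∅ .empty) (by simp)
  let π : Measure X := Measure.ofMeasurable (fun s _ => ENNReal.ofReal (p s))
    (by simp [hempty]) (fun f hf hd => by
      rw [← (hsum f hf hd).tsum_eq,
        ENNReal.ofReal_tsum_of_nonneg (fun i => hp0 _ (hf i)) (hsum f hf hd).summable])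
  have hπ : ∀ A, MeasurableSet A → π A = ENNReal.ofReal (p A) := fun A hA =>
    Measure.ofMeasurable_apply A hA
  refine ⟨π, ⟨?_⟩, fun A hA => ?_⟩
  · rw [hπ _ .univ, tendsto_nhds_unique (hp _ .univ) (by simp : Tendsto _ _ (𝓝 (1 : ℝ)))]
    simp
  · rw [hπ A hA]
    refine (ENNReal.tendsto_ofReal (hp A hA)).congr fun n => ?_
    rw [measureReal_def, ENNReal.ofReal_toReal (measure_ne_top _ _)]

-- Fatou's lemma for varying measures: integrals of simple functions converge, and `f` is a supremum
-- of simple functions.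
open Filter Topology in
theorem lintegral_le_liminf_of_tendsto_setwise {X : Type*} [MeasurableSpace X]
    {μ : ℕ → Measure X} {π : Measure X}
    (h : ∀ A, MeasurableSet A → Tendsto (fun n => μ n A) atTop (𝓝 (π A)))
    {f : X → ENNReal} (hf : Measurable f) :
    ∫⁻ x, f x ∂π ≤ liminf (fun n => ∫⁻ x, f x ∂μ n) atTop := by
  rw [lintegral_eq_iSup_eapprox_lintegral hf]
  refine iSup_le fun k => ?_
  have h1 : Tendsto (fun n => (SimpleFunc.eapprox f k).lintegral (μ n)) atTop
      (𝓝 ((SimpleFunc.eapprox f k).lintegral π)) := by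
    refine tendsto_finsetSum _ fun y hy => ?_
    refine ENNReal.Tendsto.const_mul (h _ (SimpleFunc.measurableSet_fiber _ _)) (Or.inr ?_)
    obtain ⟨x, rfl⟩ := SimpleFunc.mem_range.1 hy
    exact (SimpleFunc.eapprox_lt_top f k x).ne
  rw [← h1.liminf_eq]
  refine liminf_le_liminf (Eventually.of_forall fun n => ?_)
  rw [lintegral_eq_iSup_eapprox_lintegral hf]
  exact le_iSup (fun k => (SimpleFunc.eapprox f k).lintegral (μ n)) k

/-! ### Powers of a Markov kernel and Harris' theorem -/

instance ProbabilityTheory.Kernel.isMarkovKernel_pow {X : Type*} [MeasurableSpace X]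
    (K : Kernel X X) [IsMarkovKernel K] (n : ℕ) : IsMarkovKernel (K ^ n) := by
  induction n with
  | zero => exact inferInstanceAs (IsMarkovKernel (Kernel.id : Kernel X X))
  | succ n ih =>
    rw [pow_succ]
    exact inferInstanceAs (IsMarkovKernel ((K ^ n) ∘ₖ K))

theorem MeasureTheory.Integrable.integral_bind {X Y : Type*} [MeasurableSpace X]
    [MeasurableSpace Y] {K : Kernel X Y} {μ : Measure X} {φ : Y → ℝ}
    (h : Integrable φ (μ.bind K)) : ∫ y, φ y ∂(μ.bind K) = ∫ x, ∫ y, φ y ∂K x ∂μ := by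
  rw [Measure.comp_eq_comp_const_apply] at h ⊢
  rw [Kernel.integral_comp h, Kernel.const_apply]

/-- Functions of oscillation at most `c * (W x + W y)`. -/
def HasOscBound {X : Type*} (W φ : X → ℝ) (c : ℝ) : Prop :=
  ∀ x y, |φ x - φ y| ≤ c * (W x + W y)

theorem HasOscBound.exists_center {X : Type*} [Nonempty X] {W φ : X → ℝ} {c : ℝ}
    (h : HasOscBound W φ c) : ∃ s, ∀ x, |φ x - s| ≤ c * W x :=
  exists_center_of_abs_sub_le h

theorem HasOscBound.integrable {X : Type*} [MeasurableSpace X] [Nonempty X] {μ : Measure X}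
    [IsFiniteMeasure μ] {W φ : X → ℝ} {c : ℝ}
    (h : HasOscBound W φ c) (hφ : Measurable φ) (hW : Integrable W μ) : Integrable φ μ :=
  h.exists_center.elim fun _ hs => Integrable.of_abs_sub_le hφ hW hs

theorem HasDrift.comp {X : Type*} [MeasurableSpace X] {K₁ K₂ : Kernel X X}
    [IsMarkovKernel K₂] {V : X → ℝ} (hVm : Measurable V) (hV0 : ∀ x, 0 ≤ V x)
    {γ₁ γ₂ B₁ B₂ : ℝ} (hγ₁ : 0 ≤ γ₁) (h₁ : HasDrift K₁ V γ₁ B₁) (h₂ : HasDrift K₂ V γ₂ B₂) :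
    HasDrift (K₁ ∘ₖ K₂) V (γ₁ * γ₂) (γ₁ * B₂ + B₁) := by
  intro x
  have hi : Integrable (fun y => γ₁ * V y + B₁) (K₂ x) :=
    ((h₂ x).1.const_mul γ₁).add (integrable_const B₁)
  have hm : Measurable fun y => ∫ z, V z ∂K₁ y :=
    hVm.stronglyMeasurable.integral_kernel.measurable
  have hint : Integrable (fun y => ∫ z, V z ∂K₁ y) (K₂ x) :=
    hi.mono' hm.aestronglyMeasurable (ae_of_all _ fun y => by
      rw [Real.norm_of_nonneg (integral_nonneg hV0)]; exact (h₁ y).2)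
  have hcomp : Integrable V ((K₁ ∘ₖ K₂) x) := by
    rw [integrable_comp_iff hVm.aestronglyMeasurable]
    refine ⟨ae_of_all _ fun y => (h₁ y).1, ?_⟩
    simpa only [Real.norm_of_nonneg (hV0 _)] using hint
  refine ⟨hcomp, ?_⟩
  rw [Kernel.integral_comp hcomp]
  refine (integral_mono hint hi fun y => (h₁ y).2).trans ?_
  rw [integral_add ((h₂ x).1.const_mul γ₁) (integrable_const B₁), integral_const_mul]
  have := mul_le_mul_of_nonneg_left (h₂ x).2 hγ₁
  simp only [integral_const, probReal_univ, smul_eq_mul, one_mul]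
  linarith

theorem HasDrift.pow {X : Type*} [MeasurableSpace X] {K : Kernel X X}
    [IsMarkovKernel K] {V : X → ℝ} (hVm : Measurable V) (hV0 : ∀ x, 0 ≤ V x)
    {γ B : ℝ} (hγ0 : 0 ≤ γ) (hγ1 : γ < 1) (hB : 0 ≤ B) (h : HasDrift K V γ B) (n : ℕ) :
    HasDrift (K ^ n) V (γ ^ n) (B / (1 - γ)) := by
  have h1 : 0 < 1 - γ := by linarith
  induction n with
  | zero =>
    intro x
    change Integrable V (Kernel.id x) ∧ ∫ y, V y ∂(Kernel.id x) ≤ _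
    have : 0 ≤ B / (1 - γ) := by positivity
    rw [Kernel.id_apply]
    refine ⟨integrable_dirac' hVm.stronglyMeasurable (by simp), ?_⟩
    rw [integral_dirac' _ _ hVm.stronglyMeasurable]
    linarith
  | succ n ih =>
    have h2 := HasDrift.comp hVm hV0 hγ0 h ih
    rw [pow_succ' K, pow_succ' γ]
    -- The constant is the fixed point of `t ↦ γ t + B`, hence the same for all powers.
    have e : γ * (B / (1 - γ)) + B = B / (1 - γ) := by field_simp; ring
    rwa [e] at h2

/-- Two-step contraction of the oscillation seminorm gives geometric decay of all iterates. -/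
theorem exists_pow_contraction {X : Type*} [MeasurableSpace X] [Nonempty X] {K : Kernel X X}
    [IsMarkovKernel K] {W : X → ℝ} (hW1 : ∀ x, 1 ≤ W x)
    (hWi : ∀ n x, Integrable W ((K ^ n) x)) {ρ : ℝ} (hρ : 0 < ρ)
    (hc : ∀ (c : ℝ) (φ : X → ℝ), 0 ≤ c → Measurable φ → HasOscBound W φ c →
      HasOscBound W (fun x => ∫ z, φ z ∂(K ∘ₖ K) x) (ρ * c))
    {M : ℝ} (hM : ∀ x, ∫ z, W z ∂K x ≤ M * W x) :
    ∃ C : ℝ, 0 ≤ C ∧ ∀ (n : ℕ) (c : ℝ) (φ : X → ℝ), 0 ≤ c → Measurable φ → HasOscBound W φ c →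
      HasOscBound W (fun x => ∫ z, φ z ∂(K ^ n) x) (C * √ρ ^ n * c) := by
  set r := √ρ with hr
  have hr0 : 0 < r := Real.sqrt_pos.2 hρ
  have hr2 : r ^ 2 = ρ := Real.sq_sqrt hρ.le
  -- `1` serves `n = 0` and `M / r` serves `n = 1`; each further pair of steps costs `ρ = r ^ 2`.
  refine ⟨max 1 (M / r), le_max_of_le_left zero_le_one, fun n => ?_⟩
  have hMC : M ≤ max 1 (M / r) * r := by
    rw [← div_le_iff₀ hr0]; exact le_max_right _ _
  have hC1 : 1 ≤ max 1 (M / r) := le_max_left _ _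
  set C := max 1 (M / r)
  induction n using Nat.twoStepInduction with
  | zero =>
    intro c φ hc0 hφ h x y
    change |∫ z, φ z ∂(Kernel.id x) - ∫ z, φ z ∂(Kernel.id y)| ≤ _
    rw [Kernel.id_apply, Kernel.id_apply, integral_dirac' _ _ hφ.stronglyMeasurable,
      integral_dirac' _ _ hφ.stronglyMeasurable]
    refine (h x y).trans ?_
    have : 0 ≤ W x + W y := by linarith [hW1 x, hW1 y]
    have h2 : c ≤ C * c := by nlinarith
    simpa using mul_le_mul_of_nonneg_right h2 this
  | one =>
    intro c φ hc0 hφ h x y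
    rw [pow_one, pow_one]
    obtain ⟨s, hs⟩ := h.exists_center
    have hWK : ∀ x, Integrable W (K x) := fun x => by simpa using hWi 1 x
    have key := abs_integral_sub_integral_le_of_le (Measure.zero_le (K x)) (Measure.zero_le (K y))
      hφ hs hc0 hW1 (hWK x) (hWK y)
    refine key.trans ?_
    have h1 := hM x
    have h2 := hM y
    have h3 : M * (W x + W y) ≤ C * r * (W x + W y) :=
      mul_le_mul_of_nonneg_right hMC (by linarith [hW1 x, hW1 y])
    have h4 : ∫ z, W z ∂K x + ∫ z, W z ∂K y ≤ C * r * (W x + W y) := by linarith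
    have h5 := mul_le_mul_of_nonneg_left h4 hc0
    simp only [measureReal_zero, Pi.zero_apply, mul_zero, sub_zero]
    linarith
  | more n ih _ =>
    intro c φ hc0 hφ h
    have h1 := ih (ρ * c) (fun x => ∫ z, φ z ∂(K ∘ₖ K) x) (by positivity)
      hφ.stronglyMeasurable.integral_kernel.measurable (hc c φ hc0 hφ h)
    have e1 : K ^ (n + 2) = (K ∘ₖ K) ∘ₖ (K ^ n) := by
      rw [add_comm, pow_add, pow_two]; rfl
    have e2 : ∀ x, ∫ z, φ z ∂(K ^ (n + 2)) x = ∫ y, ∫ z, φ z ∂(K ∘ₖ K) y ∂(K ^ n) x := fun x => by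
      have hi := h.integrable hφ (hWi (n + 2) x)
      rw [e1] at hi ⊢
      exact Kernel.integral_comp hi
    have e3 : C * r ^ (n + 2) * c = C * r ^ n * (ρ * c) := by rw [← hr2]; ring
    simp only [e2, e3]
    exact h1

theorem HasOscBound.abs_integral_sub_le {X : Type*} [MeasurableSpace X] {W ψ : X → ℝ} {D : ℝ}
    (h : HasOscBound W ψ D) (hψ : Measurable ψ) {μ : Measure X} [IsProbabilityMeasure μ]
    (hW : Integrable W μ) (x : X) : |∫ y, ψ y ∂μ - ψ x| ≤ D * (∫ y, W y ∂μ + W x) := by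
  have : Nonempty X := ⟨x⟩
  have hi := h.integrable hψ hW
  have e : ∫ y, ψ y ∂μ - ψ x = ∫ y, (ψ y - ψ x) ∂μ := by
    rw [integral_sub hi (integrable_const _)]; simp
  have hWi : Integrable (fun y => W y + W x) μ := hW.add (integrable_const _)
  rw [e]
  calc |∫ y, (ψ y - ψ x) ∂μ| ≤ ∫ y, |ψ y - ψ x| ∂μ := abs_integral_le_integral_abs
    _ ≤ ∫ y, D * (W y + W x) ∂μ :=
      integral_mono (hi.sub (integrable_const _)).abs (hWi.const_mul D) fun y => h y x
    _ = D * (∫ y, W y ∂μ + W x) := by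
      rw [integral_const_mul, integral_add hW (integrable_const _)]; simp

theorem ProbabilityTheory.Kernel.Invariant.pow {X : Type*} [MeasurableSpace X] {K : Kernel X X}
    {μ : Measure X} (h : K.Invariant μ) (n : ℕ) : (K ^ n).Invariant μ := by
  induction n with
  | zero => exact Measure.bind_dirac
  | succ n ih => rw [pow_succ]; exact ih.comp h

open Filter Topology in
/-- An iterate of a kernel forgetting its starting point has at most one invariant probability
measure. -/
theorem eq_of_invariant_of_tendsto {X : Type*} [MeasurableSpace X] {K : Kernel X X}
    [IsMarkovKernel K] {π ν : Measure X} [IsProbabilityMeasure ν] (hν : K.Invariant ν)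
    (h : ∀ A, MeasurableSet A → ∀ x, Tendsto (fun n => (K ^ n) x A) atTop (𝓝 (π A))) :
    ν = π := by
  ext A hA
  have h1 : ∀ n, ∫⁻ x, (K ^ n) x A ∂ν = ν A := fun n => by
    rw [← Measure.bind_apply hA (K ^ n : Kernel X X).aemeasurable, (hν.pow n).def]
  have h2 : Tendsto (fun n => ∫⁻ x, (K ^ n) x A ∂ν) atTop (𝓝 (∫⁻ _, π A ∂ν)) :=
    tendsto_lintegral_of_dominated_convergence (fun _ => 1)
      (fun n => (K ^ n).measurable_coe hA) (fun n => ae_of_all _ fun x => prob_le_one)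
      (by simp) (ae_of_all _ fun x => h A hA x)
  simp only [h1, lintegral_const, measure_univ, mul_one] at h2
  exact tendsto_nhds_unique tendsto_const_nhds h2

theorem hasOscBound_indicator {X : Type*} {W : X → ℝ} (hW1 : ∀ x, 1 ≤ W x) (A : Set X) :
    HasOscBound W (A.indicator fun _ => (1 : ℝ)) 1 := fun x y => by
  have h1 := hW1 x
  have h2 := hW1 y
  by_cases hx : x ∈ A <;> by_cases hy : y ∈ A <;> simp [hx, hy] <;> linarith

open Filter Topology in
theorem tendsto_measure_of_abs_integral_sub_le {X : Type*} [MeasurableSpace X] {W : X → ℝ}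
    (hW1 : ∀ x, 1 ≤ W x) {μ : ℕ → Measure X} {π : Measure X} [∀ n, IsFiniteMeasure (μ n)]
    [IsFiniteMeasure π] {u : ℕ → ℝ} (hu : Tendsto u atTop (𝓝 0))
    (h : ∀ φ, Measurable φ → HasOscBound W φ 1 → ∀ n, |∫ x, φ x ∂μ n - ∫ x, φ x ∂π| ≤ u n)
    {A : Set X} (hA : MeasurableSet A) : Tendsto (fun n => μ n A) atTop (𝓝 (π A)) := by
  have h1 : Tendsto (fun n => (μ n).real A) atTop (𝓝 (π.real A)) := by
    rw [tendsto_iff_dist_tendsto_zero]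
    refine squeeze_zero (fun _ => dist_nonneg) (fun n => ?_) hu
    have := h _ (measurable_const.indicator hA) (hasOscBound_indicator hW1 A) n
    rw [Real.dist_eq]
    simpa [integral_indicator hA] using this
  have h2 := ENNReal.tendsto_ofReal h1
  simpa only [measureReal_def, ENNReal.ofReal_toReal (measure_ne_top _ _)] using h2

/-- **Harris' theorem** with a two-step minorization condition. -/
theorem exists_invariant_of_drift_of_minorization {X : Type*} [MeasurableSpace X] [Nonempty X]
    {K : Kernel X X} [IsMarkovKernel K] {V : X → ℝ} (hVm : Measurable V) (hV0 : ∀ x, 0 ≤ V x)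
    {γ B : ℝ} (hγ0 : 0 ≤ γ) (hγ1 : γ < 1) (hB : 0 ≤ B) (hK : HasDrift K V γ B)
    (hmin : ∀ R, ∃ ν : Measure X, IsFiniteMeasure ν ∧ ν ≠ 0 ∧ ∀ x, V x ≤ R → ν ≤ (K ∘ₖ K) x) :
    ∃ π : Measure X, IsProbabilityMeasure π ∧ Integrable V π ∧ K.Invariant π ∧
      (∀ ν : Measure X, IsProbabilityMeasure ν → K.Invariant ν → ν = π) ∧
      ∃ r : ℝ, 0 < r ∧ r < 1 ∧ ∃ M : ℝ, ∀ (c : ℝ) (φ : X → ℝ), 0 ≤ c → Measurable φ →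
        (∀ x, |φ x| ≤ c * (1 + V x)) → Integrable φ π ∧ ∀ x n, Integrable φ ((K ^ n) x) ∧
          |∫ y, φ y ∂(K ^ n) x - ∫ y, φ y ∂π| ≤ c * M * r ^ n * (1 + V x) := by
  have hK2 := HasDrift.comp hVm hV0 hγ0 hK hK
  have hγγ : γ * γ < 1 := by nlinarith
  obtain ⟨R, hR⟩ : ∃ R, 2 * (γ * B + B) < (1 - γ * γ) * R := by
    refine ⟨(2 * (γ * B + B) + 1) / (1 - γ * γ), ?_⟩
    rw [mul_div_cancel₀ _ (by linarith)]
    linarith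
  obtain ⟨ν, _, hν, hνK⟩ := hmin R
  obtain ⟨b, hb, ρ, hρ0, hρ1, hcontr⟩ :=
    hK2.exists_contraction hV0 hγγ (by positivity) hR hν hνK
  set W : X → ℝ := fun x => 1 + b * V x with hW
  have hbV : ∀ x, 0 ≤ b * V x := fun x => mul_nonneg hb.le (hV0 x)
  have hW1 : ∀ x, 1 ≤ W x := fun x => by simp only [hW]; linarith [hbV x]
  have hWi : ∀ μ : Measure X, [IsProbabilityMeasure μ] → Integrable V μ → Integrable W μ :=
    fun μ _ h => (integrable_const 1).add (h.const_mul b)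
  have hWint : ∀ μ : Measure X, [IsProbabilityMeasure μ] → Integrable V μ →
      ∫ x, W x ∂μ = 1 + b * ∫ x, V x ∂μ := fun μ _ h => by
    rw [hW, integral_add (integrable_const 1) (h.const_mul b), integral_const_mul]; simp
  have hpow := HasDrift.pow hVm hV0 hγ0 hγ1 hB hK
  have hWpow : ∀ n x, Integrable W ((K ^ n) x) := fun n x => hWi _ (hpow n x).1
  obtain ⟨C, hC0, hC⟩ := exists_pow_contraction hW1 hWpow hρ0 hcontr
    (M := 1 + b * B) (fun x => by
      rw [hWint _ (hK x).1]
      have h1 := mul_le_mul_of_nonneg_left (hK x).2 hb.le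
      have h2 : γ * (b * V x) ≤ b * V x := mul_le_of_le_one_left (hbV x) hγ1.le
      have h3 : 0 ≤ b * B * (b * V x) := mul_nonneg (by positivity) (hbV x)
      simp only [hW]; nlinarith)
  set r := √ρ with hr
  have hr0 : 0 < r := Real.sqrt_pos.2 hρ0
  have hr1 : r < 1 := by rw [hr, Real.sqrt_lt' one_pos]; simpa using hρ1
  have hrlim : ∀ t : ℝ, Filter.Tendsto (fun n => C * r ^ n * t) Filter.atTop (nhds 0) := fun t => by
    simpa using ((tendsto_pow_atTop_nhds_zero_of_lt_one hr0.le hr1).const_mul C).mul_const t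
  have hmix : ∀ (μ : Measure X) [IsProbabilityMeasure μ], Integrable V μ → ∀ (c : ℝ) (φ : X → ℝ) n,
      0 ≤ c → Measurable φ → HasOscBound W φ c → Integrable φ (μ.bind ⇑(K ^ n : Kernel X X)) → ∀ x,
      |∫ y, φ y ∂(μ.bind ⇑(K ^ n : Kernel X X)) - ∫ y, φ y ∂(K ^ n) x| ≤
        C * r ^ n * (c * (1 + b * ∫ x, V x ∂μ + W x)) := by
    intro μ _ hμ c φ n hc hφ hosc hi x
    rw [hi.integral_bind, ← hWint μ hμ, ← mul_assoc]
    exact (hC n c φ hc hφ hosc).abs_integral_sub_le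
      hφ.stronglyMeasurable.integral_kernel.measurable (hWi μ hμ) x
  obtain ⟨x₀⟩ := ‹Nonempty X›
  have : Nonempty X := ⟨x₀⟩
  -- The law at time `n + m` is that at time `n` started from `(K ^ m) x₀`, whose `V`-moment is
  -- bounded uniformly in `m` by the drift.
  obtain ⟨π, hπP, hπ⟩ := exists_setwise_limit_of_uniform_cauchy (μ := fun n => (K ^ n) x₀)
    (hrlim (1 * (1 + b * (1 * V x₀ + B / (1 - γ)) + W x₀))) (fun n m A hA => by
      have hbind : ((K ^ m) x₀).bind ⇑(K ^ n : Kernel X X) = (K ^ (n + m)) x₀ := by rw [pow_add]; rfl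
      have hA' : Measurable (A.indicator fun _ => (1 : ℝ)) := measurable_const.indicator hA
      have hosc := hasOscBound_indicator hW1 A
      have key := hmix ((K ^ m) x₀) (hpow m x₀).1 1 _ n zero_le_one hA' hosc
        (by rw [hbind]; exact hosc.integrable hA' (hWpow _ _)) x₀
      rw [hbind] at key
      simp only [integral_indicator hA, setIntegral_const, smul_eq_mul, mul_one] at key
      refine key.trans ?_
      have h1 : ∫ x, V x ∂(K ^ m) x₀ ≤ 1 * V x₀ + B / (1 - γ) :=
        (hpow m x₀).2.trans (by
          have := mul_le_mul_of_nonneg_right (pow_le_one₀ hγ0 hγ1.le (n := m)) (hV0 x₀)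
          linarith)
      gcongr)
  have hπV : Integrable V π := by
    refine ⟨hVm.aestronglyMeasurable, ?_⟩
    rw [hasFiniteIntegral_iff_ofReal (ae_of_all _ hV0)]
    refine (lintegral_le_liminf_of_tendsto_setwise hπ hVm.ennreal_ofReal).trans_lt ?_
    refine lt_of_le_of_lt (b := ENNReal.ofReal (1 * V x₀ + B / (1 - γ))) ?_ ENNReal.ofReal_lt_top
    refine Filter.liminf_le_of_le (by isBoundedDefault) fun t ht => ?_
    obtain ⟨n, hn⟩ := ht.exists
    refine hn.trans ?_
    rw [← ofReal_integral_eq_lintegral_ofReal (hpow n x₀).1 (ae_of_all _ hV0)]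
    refine ENNReal.ofReal_le_ofReal ((hpow n x₀).2.trans ?_)
    have := mul_le_mul_of_nonneg_right (pow_le_one₀ hγ0 hγ1.le (n := n)) (hV0 x₀)
    linarith
  have hπK : K.Invariant π := by
    have : IsProbabilityMeasure (π.bind K) := inferInstance
    -- Fatou gives only one inequality between `π.bind K` and `π`; equal total mass supplies the
    -- other.
    refine Measure.eq_of_le_of_isProbabilityMeasure (Measure.le_iff.2 fun A hA => ?_)
    rw [Measure.bind_apply hA K.aemeasurable]
    refine (lintegral_le_liminf_of_tendsto_setwise hπ (K.measurable_coe hA)).trans ?_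
    have h1 : ∀ n, ∫⁻ x, K x A ∂(K ^ n) x₀ = (K ^ (n + 1)) x₀ A := fun n =>
      (Kernel.pow_succ_apply_eq_lintegral K n x₀ hA).symm
    simp only [h1]
    exact ((hπ A hA).comp (Filter.tendsto_add_atTop_nat 1)).liminf_eq.le
  have hconv : ∀ (c : ℝ) (φ : X → ℝ) n, 0 ≤ c → Measurable φ → HasOscBound W φ c → ∀ x,
      |∫ y, φ y ∂(K ^ n) x - ∫ y, φ y ∂π| ≤ C * r ^ n * (c * (1 + b * ∫ x, V x ∂π + W x)) := by
    intro c φ n hc hφ hosc x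
    have e := (hπK.pow n).def
    have key := hmix π hπV c φ n hc hφ hosc (by rw [e]; exact hosc.integrable hφ (hWi π hπV)) x
    rwa [e, abs_sub_comm] at key
  refine ⟨π, hπP, hπV, hπK, fun ν' _ hν' => eq_of_invariant_of_tendsto hν' fun A hA x =>
    tendsto_measure_of_abs_integral_sub_le hW1 (hrlim _)
      (fun φ hφ hosc n => hconv 1 φ n zero_le_one hφ hosc x) hA, r, hr0, hr1,
    (1 + 1 / b) * C * (2 + b + b * ∫ x, V x ∂π), fun c φ hc hφ hbound => ?_⟩
  have hosc : HasOscBound W φ (c * (1 + 1 / b)) := fun x y => by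
    have h1 : ∀ x, 1 + V x ≤ (1 + 1 / b) * W x := fun x => by
      have h2 : (1 + 1 / b) * W x = 1 + V x + (b * V x + 1 / b) := by
        simp only [hW]; field_simp; ring
      have h3 := hbV x
      have : 0 < 1 / b := by positivity
      linarith
    have h2 := mul_le_mul_of_nonneg_left (h1 x) hc
    have h3 := mul_le_mul_of_nonneg_left (h1 y) hc
    have h4 := abs_sub (φ x) (φ y)
    linarith [hbound x, hbound y]
  refine ⟨hosc.integrable hφ (hWi π hπV), fun x n => ⟨hosc.integrable hφ (hWpow n x), ?_⟩⟩
  refine (hconv _ φ n (by positivity) hφ hosc x).trans ?_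
  have hI : 0 ≤ ∫ x, V x ∂π := integral_nonneg hV0
  have hfin : 1 + b * ∫ x, V x ∂π + W x ≤ (2 + b + b * ∫ x, V x ∂π) * (1 + V x) := by
    have h1 : 0 ≤ (b * ∫ x, V x ∂π) * V x := mul_nonneg (mul_nonneg hb.le hI) (hV0 x)
    have h2 := hV0 x
    simp only [hW]
    nlinarith
  calc C * r ^ n * (c * (1 + 1 / b) * (1 + b * ∫ x, V x ∂π + W x))
      ≤ C * r ^ n * (c * (1 + 1 / b) * ((2 + b + b * ∫ x, V x ∂π) * (1 + V x))) := by gcongr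
    _ = _ := by ring

/-! ### Measurable lower bounds of families of functions -/

/-- A measurable version of the pointwise infimum, capped at `1`, of an arbitrary family of
measurable functions: it is a.e. below each member and everywhere above the pointwise infimum. -/
theorem exists_measurable_ae_le_of_iInf_le {X ι : Type*} [MeasurableSpace X] [Nonempty ι]
    (μ : Measure X) [SFinite μ] {p : ι → X → ENNReal} (hp : ∀ i, Measurable (p i)) :
    ∃ m : X → ENNReal, Measurable m ∧ (∀ x, m x ≤ 1) ∧ (∀ i, m ≤ᵐ[μ] p i) ∧
      ∀ x, min (⨅ i, p i x) 1 ≤ m x := by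
  set w := μ.toFinite
  set J : (ℕ → ι) → X → ENNReal := fun s x => ⨅ n, min (p (s n) x) 1 with hJ
  have hJm : ∀ s, Measurable (J s) := fun s =>
    .iInf fun n => (hp (s n)).min measurable_const
  have hJ1 : ∀ s x, J s x ≤ 1 := fun s x => (iInf_le _ 0).trans (min_le_right _ _)
  -- Among countable capped infima, one has minimal integral: the index sequences of a minimizing
  -- sequence are merged into `s` by pairing.
  obtain ⟨u, -, hu, hus⟩ := exists_seq_tendsto_sInf
    (Set.range_nonempty fun s => ∫⁻ x, J s x ∂w) (OrderBot.bddBelow _)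
  choose S hS using hus
  set s : ℕ → ι := fun n => S n.unpair.1 n.unpair.2 with hs
  have hsS : ∀ k x, J s x ≤ J (S k) x := fun k x => le_iInf fun n => by
    refine (iInf_le _ (Nat.pair k n)).trans ?_
    simp [hs]
  have hmin : ∀ t, ∫⁻ x, J s x ∂w ≤ ∫⁻ x, J t x ∂w := fun t => by
    have ht : sInf (Set.range fun s => ∫⁻ x, J s x ∂w) ≤ ∫⁻ x, J t x ∂w := sInf_le ⟨t, rfl⟩
    refine le_trans ?_ ht
    refine ge_of_tendsto' hu fun k => ?_
    rw [← hS k]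
    exact lintegral_mono (hsS k)
  refine ⟨J s, hJm s, hJ1 s, fun i => ?_, fun x => ?_⟩
  -- Adjoining `i` cannot lower the minimal integral, so it changes the infimum only on a null set.
  · set t : ℕ → ι := fun n => Nat.casesOn n i s with ht
    have hts : ∀ x, J t x ≤ J s x := fun x => le_iInf fun n => iInf_le _ (n + 1)
    have hfin : ∫⁻ x, J t x ∂w ≠ ⊤ := by
      refine ((lintegral_mono (hJ1 t)).trans_lt ?_).ne
      simp
    have hae := ae_eq_of_ae_le_of_lintegral_le (ae_of_all w hts) hfin (hJm s).aemeasurable (hmin t)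
    have hae' : ∀ᵐ x ∂w, J s x ≤ p i x := by
      filter_upwards [hae] with x hx
      rw [← hx]
      exact (iInf_le _ 0).trans (min_le_left _ _)
    rwa [ae_toFinite] at hae'
  · exact le_iInf fun n => min_le_min_right _ (iInf_le _ _)

/-- A positive measurable lower bound, uniform for `x` in a ball, of a family of functions that is
positive and continuous in `x`. -/
theorem exists_measurable_pos_le_of_continuous {E Z : Type*} [PseudoMetricSpace E] [ProperSpace E]
    [MeasurableSpace Z] {F : E → Z → ENNReal} (hFm : ∀ x, Measurable (F x))
    (hFc : ∀ z, Continuous fun x => F x z)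
    (hFpos : ∀ x z, 0 < F x z) (x₀ : E) {ρ : ℝ} (hρ : 0 < ρ) :
    ∃ G : Z → ENNReal, Measurable G ∧ (∀ z, 0 < G z) ∧ ∀ x ∈ Metric.ball x₀ ρ, ∀ z,
      G z ≤ F x z := by
  -- The infimum over a countable dense subset of the ball is measurable; compactness makes it
  -- positive, and continuity extends the bound to the whole ball.
  obtain ⟨D, hDc, hD⟩ := TopologicalSpace.exists_countable_dense E
  set S := Metric.ball x₀ ρ ∩ D
  refine ⟨fun z => ⨅ x ∈ S, F x z, .biInf S (hDc.mono Set.inter_subset_right) fun x _ => hFm x,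
    fun z => ?_, fun x hx z => ?_⟩
  · obtain ⟨x₁, -, hx₁⟩ := (isCompact_closedBall x₀ ρ).exists_isMinOn
      (Metric.nonempty_closedBall.2 hρ.le) (hFc z).continuousOn
    exact (hFpos x₁ z).trans_le
      (le_iInf₂ fun x hx => hx₁ (Metric.ball_subset_closedBall hx.1))
  · have hcl : IsClosed {x | ⨅ x ∈ S, F x z ≤ F x z} := isClosed_le continuous_const (hFc z)
    exact hcl.closure_subset_iff.2 (fun y hy => iInf₂_le (f := fun x _ => F x z) y hy)
      (hD.open_subset_closure_inter Metric.isOpen_ball hx)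

/-! ### Translates of a density and two-step minorization -/

section Translation

variable {E : Type*} [NormedAddCommGroup E] [NormedSpace ℝ E] [FiniteDimensional ℝ E]
  [MeasurableSpace E] [BorelSpace E] {μ : Measure E} [μ.IsAddHaarMeasure]

open Filter Topology in
/-- Translation is continuous in `L¹`. -/
theorem tendsto_integral_norm_translate_sub {f : E → ℝ} (hf : Integrable f μ) (x₀ : E) :
    Tendsto (fun x => ∫ y, ‖f (x + y) - f (x₀ + y)‖ ∂μ) (𝓝 x₀) (𝓝 0) := by
  have hfp : MemLp f 1 μ := memLp_one_iff_integrable.2 hf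
  have : Fact ((1 : ENNReal) ≠ ⊤) := ⟨ENNReal.one_ne_top⟩
  have hc : Continuous fun x : E => DomAddAct.mk x +ᵥ hfp.toLp f :=
    (DomAddAct.continuous_mk).vadd continuous_const
  have h1 := tendsto_iff_dist_tendsto_zero.1 (hc.tendsto x₀)
  refine h1.congr fun x => ?_
  rw [DomAddAct.mk_vadd_toLp, DomAddAct.mk_vadd_toLp, dist_eq_norm, ← MemLp.toLp_sub,
    Lp.norm_toLp, eLpNorm_one_eq_lintegral_enorm, integral_norm_eq_lintegral_enorm]
  · rfl
  · exact ((hf.comp_add_left x).sub (hf.comp_add_left x₀)).aestronglyMeasurable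

-- As `r` is bounded by `1`, the increment in `x` is at most the `L¹` distance between two
-- translates of the reflected `q`.
open Filter Topology in
theorem continuous_integral_sub_mul {q r : E → ℝ} (hq : Integrable q μ) (hr : Measurable r)
    (hr1 : ∀ y, ‖r y‖ ≤ 1) : Continuous fun x => ∫ y, q (x - y) * r y ∂μ := by
  have hf : Integrable (fun y => q (-y)) μ := hq.comp_neg
  have hi : ∀ x, Integrable (fun y => q (x - y) * r y) μ := fun x =>
    (hq.comp_sub_left x).mul_bdd hr.aestronglyMeasurable (ae_of_all _ hr1)
  rw [continuous_iff_continuousAt]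
  intro x₀
  rw [ContinuousAt, tendsto_iff_norm_sub_tendsto_zero]
  have hlim := (tendsto_integral_norm_translate_sub hf (-x₀)).comp (continuous_neg.tendsto x₀)
  refine squeeze_zero (fun _ => norm_nonneg _) (fun x => ?_) hlim
  rw [← integral_sub (hi x) (hi x₀)]
  refine (norm_integral_le_integral_norm _).trans (integral_mono ((hi x).sub (hi x₀)).norm
    ((hf.comp_add_left (-x)).sub (hf.comp_add_left (-x₀))).norm fun y => ?_)
  change ‖q (x - y) * r y - q (x₀ - y) * r y‖ ≤ ‖q (-(-x + y)) - q (-(-x₀ + y))‖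
  rw [← sub_mul, norm_mul, neg_add_eq_sub, neg_add_eq_sub, neg_sub, neg_sub]
  exact mul_le_of_le_one_right (norm_nonneg _) (hr1 y)

theorem continuous_lintegral_sub_mul {q r : E → ENNReal} (hq : Measurable q) (hq1 : ∀ x, q x ≤ 1)
    (hqi : ∫⁻ x, q x ∂μ ≠ ⊤) (hr : Measurable r) (hr1 : ∀ y, r y ≤ 1) :
    Continuous fun x => ∫⁻ y, q (x - y) * r y ∂μ := by
  have hqf : ∀ x, q x ≠ ⊤ := fun x => ((hq1 x).trans_lt ENNReal.one_lt_top).ne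
  have hrf : ∀ x, r x ≠ ⊤ := fun x => ((hr1 x).trans_lt ENNReal.one_lt_top).ne
  have hQ : Integrable (fun x => (q x).toReal) μ := integrable_toReal_of_lintegral_ne_top
    hq.aemeasurable hqi
  have hR1 : ∀ y, ‖(r y).toReal‖ ≤ 1 := fun y => by
    rw [Real.norm_of_nonneg ENNReal.toReal_nonneg]
    exact ENNReal.toReal_le_of_le_ofReal zero_le_one (by simpa using hr1 y)
  refine (ENNReal.continuous_ofReal.comp
    (continuous_integral_sub_mul hQ hr.ennreal_toReal hR1)).congr fun x => ?_
  rw [Function.comp_apply, ofReal_integral_eq_lintegral_ofReal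
    ((hQ.comp_sub_left x).mul_bdd hr.ennreal_toReal.aestronglyMeasurable (ae_of_all _ hR1))
    (ae_of_all _ fun y => mul_nonneg ENNReal.toReal_nonneg ENNReal.toReal_nonneg)]
  refine lintegral_congr fun y => ?_
  rw [← ENNReal.toReal_mul, ENNReal.ofReal_toReal (ENNReal.mul_ne_top (hqf _) (hrf _))]

/-- Two-step minorization on a bounded set for a kernel that dominates the translates of a positive
density by a locally bounded drift; no continuity of the drift or lower bound on the density is
needed. -/
theorem exists_minorization_comp_of_translate_le {K : Kernel E E} [IsMarkovKernel K] {h : E → E}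
    (hh : Measurable h) {q : E → ENNReal} (hq : Measurable q) (hq1 : ∀ x, q x ≤ 1)
    (hq0 : ∀ x, 0 < q x) (hqi : ∫⁻ x, q x ∂μ ≠ ⊤) {C : Set E} (hC : MeasurableSet C)
    (hCμ : 0 < μ C) {ρ : ℝ} (hρ : 0 < ρ) (hhC : ∀ θ ∈ C, h θ ∈ Metric.ball 0 ρ)
    (hK : ∀ θ ∈ C, μ.withDensity (fun z => q (h θ - z)) ≤ K θ) :
    ∃ ν : Measure E, IsFiniteMeasure ν ∧ ν ≠ 0 ∧ ∀ θ ∈ C, ν ≤ (K ∘ₖ K) θ := by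
  set r : E → E → ENNReal := fun z => C.indicator fun y => q (h y - z) with hr
  have hrm : ∀ z, Measurable (r z) := fun z => (hq.comp (hh.sub_const z)).indicator hC
  have hr1 : ∀ z y, r z y ≤ 1 := fun z y =>
    Set.indicator_apply_le' (fun _ => hq1 _) fun _ => zero_le_one
  -- A lower density at `z` after two steps through `C`, with `x` standing for `h θ`. The rough
  -- drift `h y` of the second step sits inside the bounded factor, so continuity in `x` survives.
  set F : E → E → ENNReal := fun x z => ∫⁻ y, q (x - y) * r z y ∂μ with hF
  have hFC : ∀ x z, F x z = ∫⁻ y in C, q (x - y) * q (h y - z) ∂μ := fun x z => by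
    rw [← lintegral_indicator hC]
    exact lintegral_congr fun y => by by_cases hy : y ∈ C <;> simp [hr, hy]
  have hjoint : ∀ x, Measurable fun a : E × E => q (x - a.1) * q (h a.1 - a.2) := fun x => by
    fun_prop
  have hFm : ∀ x, Measurable (F x) := fun x => by
    have : F x = fun z => ∫⁻ y in C, q (x - y) * q (h y - z) ∂μ := funext (hFC x)
    rw [this]
    exact (hjoint x).lintegral_prod_left'
  have hFpos : ∀ x z, 0 < F x z := fun x z => by
    have hm : Measurable fun y => q (x - y) * q (h y - z) :=
      (hjoint x).comp (measurable_id.prodMk measurable_const)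
    rw [hFC, lintegral_pos_iff_support hm]
    have : Function.support (fun y => q (x - y) * q (h y - z)) = Set.univ :=
      Set.eq_univ_of_forall fun y => (ENNReal.mul_pos (hq0 _).ne' (hq0 _).ne').ne'
    rwa [this, Measure.restrict_apply_univ]
  obtain ⟨G, hGm, hG0, hG⟩ := exists_measurable_pos_le_of_continuous hFm
    (fun z => continuous_lintegral_sub_mul hq hq1 hqi (hrm z) (hr1 z)) hFpos 0 hρ
  have hle : ∀ θ ∈ C, μ.withDensity G ≤ (K ∘ₖ K) θ := fun θ hθ => by
    refine Measure.le_iff.2 fun A hA => ?_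
    rw [Kernel.comp_apply' _ _ _ hA, withDensity_apply _ hA]
    calc ∫⁻ z in A, G z ∂μ ≤ ∫⁻ z in A, F (h θ) z ∂μ := lintegral_mono (hG _ (hhC θ hθ))
      _ = ∫⁻ y in C, ∫⁻ z in A, q (h θ - y) * q (h y - z) ∂μ ∂μ := by
        simp only [hFC]
        exact (lintegral_lintegral_swap (hjoint (h θ)).aemeasurable).symm
      _ ≤ ∫⁻ y in C, q (h θ - y) * K y A ∂μ := by
        refine setLIntegral_mono' hC fun y hy => ?_
        rw [lintegral_const_mul _ (by fun_prop)]
        refine mul_le_mul_right ?_ _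
        rw [← withDensity_apply _ hA]
        exact hK y hy A
      _ ≤ ∫⁻ y, q (h θ - y) * K y A ∂μ := setLIntegral_le_lintegral _ _
      _ = ∫⁻ y, K y A ∂(μ.withDensity fun z => q (h θ - z)) :=
        (lintegral_withDensity_eq_lintegral_mul _ (by fun_prop) (K.measurable_coe hA)).symm
      _ ≤ ∫⁻ y, K y A ∂K θ := lintegral_mono' (hK θ hθ) le_rfl
  have hCne : C.Nonempty := nonempty_of_measure_ne_zero hCμ.ne'
  refine ⟨μ.withDensity G, isFiniteMeasure_of_le _ (hle _ hCne.some_mem), fun h0 => ?_, hle⟩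
  rw [withDensity_eq_zero_iff hGm.aemeasurable] at h0
  have : ∀ᵐ _ ∂μ, False := h0.mono fun x hx => (hG0 x).ne' hx
  rw [Filter.eventually_false_iff_eq_bot, ae_eq_bot] at this
  exact hCμ.ne' (by rw [this]; rfl)

/-- The image of a density under `t ↦ w - η • t` dominates a reflected and rescaled density. -/
theorem withDensity_sub_le_map_sub_smul {m : E → ENNReal} (hm : Measurable m) {η : ℝ} (hη : 0 < η)
    (w : E) :
    μ.withDensity (fun z => min (ENNReal.ofReal (η ^ Module.finrank ℝ E))⁻¹ 1 *
      m (η⁻¹ • (w - z))) ≤ (μ.withDensity m).map fun t => w - η • t := by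
  set c := ENNReal.ofReal (η ^ Module.finrank ℝ E) with hc
  have hc0 : c ≠ 0 := by simp only [hc, ne_eq, ENNReal.ofReal_eq_zero, not_le]; positivity
  have hct : c ≠ ⊤ := ENNReal.ofReal_ne_top
  refine Measure.le_iff.2 fun A hA => ?_
  have hmap : Measurable fun t : E => w - η • t := by fun_prop
  rw [Measure.map_apply hmap hA, withDensity_apply _ hA, withDensity_apply _ (hmap hA),
    lintegral_const_mul _ (by fun_prop), ← lintegral_indicator hA,
    ← lintegral_indicator (hmap hA)]
  set H : E → ENNReal := ((fun t => w - η • t) ⁻¹' A).indicator m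
  have hH : Measurable H := hm.indicator (hmap hA)
  have e1 : ∫⁻ z, A.indicator (fun z => m (η⁻¹ • (w - z))) z ∂μ = ∫⁻ u, H (η⁻¹ • u) ∂μ := by
    rw [← lintegral_sub_left_eq_self _ w]
    refine lintegral_congr fun u => ?_
    by_cases hu : w - u ∈ A <;> simp [H, Set.indicator, hu, smul_smul, hη.ne']
  have e2 : ∫⁻ u, H (η⁻¹ • u) ∂μ = c * ∫⁻ t, H t ∂μ := by
    rw [← lintegral_map hH (measurable_const_smul η⁻¹),
      Measure.map_addHaar_smul μ (inv_ne_zero hη.ne'), lintegral_smul_measure, inv_pow, inv_inv,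
      abs_of_pos (by positivity)]
    rfl
  rw [e1, e2]
  calc min c⁻¹ 1 * (c * ∫⁻ t, H t ∂μ) ≤ c⁻¹ * (c * ∫⁻ t, H t ∂μ) :=
        mul_le_mul_left (min_le_left _ _) _
    _ = ∫⁻ t, H t ∂μ := by rw [← mul_assoc, ENNReal.inv_mul_cancel hc0 hct, one_mul]

end Translation

/-! ### The SGD chain: Markov property, drift and minorization -/

theorem ProbabilityTheory.IndepFun.map_eq_bind {Ω S E F : Type*} [MeasurableSpace Ω]
    [MeasurableSpace S] [MeasurableSpace E] [MeasurableSpace F] {P : Measure Ω}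
    [IsProbabilityMeasure P] {X : Ω → E} {Z : Ω → S} (h : IndepFun X Z P) (hX : Measurable X)
    (hZ : Measurable Z) {Φ : E × S → F} (hΦ : Measurable Φ) {K : Kernel E F}
    (hK : ∀ x, K x = P.map fun ω => Φ (x, Z ω)) :
    P.map (fun ω => Φ (X ω, Z ω)) = (P.map X).bind K := by
  ext A hA
  have e : P.map (fun ω => Φ (X ω, Z ω)) = (P.map fun ω => (X ω, Z ω)).map Φ :=
    (Measure.map_map hΦ (hX.prodMk hZ)).symm
  have := Measure.isProbabilityMeasure_map (μ := P) hZ.aemeasurable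
  rw [e, h.map_prod_eq_prod_map_map hX.aemeasurable hZ.aemeasurable, Measure.map_apply hΦ hA,
    Measure.prod_apply (hΦ hA), Measure.bind_apply hA K.aemeasurable]
  refine lintegral_congr fun x => ?_
  rw [hK x, Measure.map_apply hZ (measurable_prodMk_left (hΦ hA)),
    Measure.map_apply (f := fun ω => Φ (x, Z ω)) ((hΦ.comp measurable_prodMk_left).comp hZ) hA]
  rfl

/-- The `k`-th iterate uses only the fields with index below `k`, which makes it independent of `𝓖
k`. -/
theorem measurable_sgdIterate_of_filtration {Ω : Type*} {d : ℕ}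
    {g : EuclideanSpace ℝ (Fin d) → EuclideanSpace ℝ (Fin d)}
    {ξ : ℕ → Ω → EuclideanSpace ℝ (Fin d) → EuclideanSpace ℝ (Fin d)} {η : ℝ}
    (hg : Measurable g) {𝓖 : ℕ → MeasurableSpace Ω}
    (hm : ∀ k, Measurable[(𝓖 k).prod inferInstance, inferInstance]
      (fun x : Ω × EuclideanSpace ℝ (Fin d) => ξ k x.1 x.2))
    (θ₀ : EuclideanSpace ℝ (Fin d)) (k : ℕ) :
    Measurable[⨆ j ∈ Set.Iio k, 𝓖 j] (sgdIterate g ξ η θ₀ k) := by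
  induction k with
  | zero => exact measurable_const
  | succ k ih =>
    set 𝓗 : MeasurableSpace Ω := ⨆ j ∈ Set.Iio (k + 1), 𝓖 j
    have h1 : Measurable[𝓗] (sgdIterate g ξ η θ₀ k) :=
      ih.mono (biSup_mono fun j (hj : j < k) => Nat.lt_succ_of_lt hj) le_rfl
    have h2 : 𝓖 k ≤ 𝓗 := le_biSup 𝓖 (Set.mem_Iio.2 (Nat.lt_succ_self k))
    have h3 : Measurable[𝓗] fun ω => ξ k ω (sgdIterate g ξ η θ₀ k ω) := by
      have hid : @Measurable Ω Ω 𝓗 (𝓖 k) id := fun s hs => h2 s hs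
      exact @Measurable.comp _ _ _ 𝓗 ((𝓖 k).prod inferInstance) _ _ _ (hm k)
        (@Measurable.prodMk _ 𝓗 _ _ (𝓖 k) _ _ _ hid h1)
    exact h1.sub (((hg.comp h1).add h3).const_smul η)

section SGD

variable {Ω : Type*} [mΩ : MeasurableSpace Ω] {P : Measure Ω} {d : ℕ}
  {g : EuclideanSpace ℝ (Fin d) → EuclideanSpace ℝ (Fin d)}
  {ξ : ℕ → Ω → EuclideanSpace ℝ (Fin d) → EuclideanSpace ℝ (Fin d)} {η : ℝ}

theorem IsIIDRandomField.measurable (h : IsIIDRandomField P ξ) (k : ℕ) :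
    Measurable fun x : Ω × EuclideanSpace ℝ (Fin d) => ξ k x.1 x.2 := by
  obtain ⟨𝓖, hle, -, hm⟩ := h.indep
  exact (hm k).mono (sup_le_sup_right (MeasurableSpace.comap_mono (hle k)) _) le_rfl

variable [IsProbabilityMeasure P]

theorem isMarkovKernel_sgdKernel (hg : Measurable g)
    (hξ : Measurable fun x : Ω × EuclideanSpace ℝ (Fin d) => ξ 0 x.1 x.2) :
    IsMarkovKernel (sgdKernel P g ξ η) := by
  refine Kernel.IsMarkovKernel.map _ ?_
  have : Measurable fun x : EuclideanSpace ℝ (Fin d) × Ω => ξ 0 x.2 x.1 := hξ.comp measurable_swap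
  exact measurable_fst.sub (((hg.comp measurable_fst).add this).const_smul η)

/-- The iterates form a Markov chain: the law of the `k`-th iterate is given by the `k`-th power of
the transition kernel. -/
theorem IsIIDRandomField.map_sgdIterate (h : IsIIDRandomField P ξ) (hg : Measurable g)
    (θ₀ : EuclideanSpace ℝ (Fin d)) (k : ℕ) :
    Measurable (sgdIterate g ξ η θ₀ k) ∧
      P.map (sgdIterate g ξ η θ₀ k) = (sgdKernel P g ξ η ^ k) θ₀ := by
  obtain ⟨𝓖, hle, hind, hm⟩ := h.indep
  have hmeas : ∀ k, Measurable (sgdIterate g ξ η θ₀ k) := fun k =>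
    (measurable_sgdIterate_of_filtration hg hm θ₀ k).mono (iSup₂_le fun j _ => hle j) le_rfl
  refine ⟨hmeas k, ?_⟩
  induction k with
  | zero =>
    change P.map (fun _ => θ₀) = Kernel.id θ₀
    rw [Measure.map_const, Kernel.id_apply]; simp
  | succ k ih =>
    have hindep : Indep (⨆ j ∈ Set.Iio k, 𝓖 j) (⨆ j ∈ ({k} : Set ℕ), 𝓖 j) P :=
      indep_iSup_of_disjoint hle hind (by simp)
    -- The whole `k`-th field is encoded as the identity into `Ω` equipped with `𝓖 k`.
    have hindep' : @IndepFun Ω (EuclideanSpace ℝ (Fin d)) Ω mΩ inferInstance (𝓖 k)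
        (sgdIterate g ξ η θ₀ k) id P := by
      refine indep_of_indep_of_le_left (indep_of_indep_of_le_right hindep ?_) ?_
      · rw [MeasurableSpace.comap_id]
        exact le_biSup 𝓖 (Set.mem_singleton k)
      · exact (measurable_sgdIterate_of_filtration hg hm θ₀ k).comap_le
    have hΦ : @Measurable (EuclideanSpace ℝ (Fin d) × Ω) _
        (@Prod.instMeasurableSpace _ _ _ (𝓖 k)) _
        (fun x => x.1 - η • (g x.1 + ξ k x.2 x.1)) := by
      let _ : MeasurableSpace Ω := 𝓖 k
      have : Measurable fun x : EuclideanSpace ℝ (Fin d) × Ω => ξ k x.2 x.1 :=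
        (hm k).comp measurable_swap
      exact measurable_fst.sub (((hg.comp measurable_fst).add this).const_smul η)
    have key := @IndepFun.map_eq_bind Ω Ω _ _ mΩ (𝓖 k) _ _ P _ _ _ hindep' (hmeas k)
      (fun s hs => hle k s hs) _ hΦ (sgdKernel P g ξ η) (fun x => by
        rw [sgdKernel_apply P η hg (h.measurable 0)]
        exact ((h.identDistrib k).comp (u := fun v => x - η • (g x + v x)) (by fun_prop)).map_eq.symm)
    rw [pow_succ']
    change _ = ((sgdKernel P g ξ η ^ k) θ₀).bind (sgdKernel P g ξ η)
    rw [← ih]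
    exact key

theorem IsGradientNoise.integral_norm_sub_sq_le {Lξ : ℝ} (hLξ : 0 ≤ Lξ)
    (h : IsGradientNoise P Lξ ξ) (θ w : EuclideanSpace ℝ (Fin d)) :
    Integrable (fun ω => ‖w - η • ξ 0 ω θ‖ ^ 2) P ∧
      ∫ ω, ‖w - η • ξ 0 ω θ‖ ^ 2 ∂P ≤ ‖w‖ ^ 2 + η ^ 2 * (Lξ * (1 + ‖θ‖) ^ 2) := by
  have hL2 := h.memLp θ
  have hi : Integrable (fun ω => ξ 0 ω θ) P := hL2.integrable (by norm_num)
  have hsq : Integrable (fun ω => ‖ξ 0 ω θ‖ ^ 2) P := hL2.integrable_norm_pow (by norm_num)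
  have hin : Integrable (fun ω => inner ℝ w (ξ 0 ω θ)) P := hi.const_inner w
  have e : ∀ ω, ‖w - η • ξ 0 ω θ‖ ^ 2 =
      ‖w‖ ^ 2 - 2 * η * inner ℝ w (ξ 0 ω θ) + η ^ 2 * ‖ξ 0 ω θ‖ ^ 2 := fun ω => by
    rw [norm_sub_sq_real, inner_smul_right, norm_smul, mul_pow, Real.norm_eq_abs, sq_abs]; ring
  simp only [e]
  have h1 : Integrable (fun ω => ‖w‖ ^ 2 - 2 * η * inner ℝ w (ξ 0 ω θ)) P :=
    (integrable_const _).sub (hin.const_mul _)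
  refine ⟨h1.add (hsq.const_mul _), ?_⟩
  rw [integral_add h1 (hsq.const_mul _), integral_sub (integrable_const _) (hin.const_mul _),
    integral_const_mul, integral_const_mul, integral_inner hi, h.centred θ]
  have h2 : ∫ ω, ‖ξ 0 ω θ‖ ^ 2 ∂P ≤ Lξ * (1 + ‖θ‖) ^ 2 := by
    have := (Real.sqrt_le_left (by positivity)).1 (h.secondMoment θ)
    rwa [mul_pow, Real.sq_sqrt hLξ] at this
  have h3 := mul_le_mul_of_nonneg_left h2 (sq_nonneg η)
  simpa using h3

theorem HasLinearGrowth.norm_sub_smul_sq_le {L α β : ℝ} (hgrowth : HasLinearGrowth L g)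
    (hdiss : IsDissipative α β g) (hη : 0 ≤ η) (θ : EuclideanSpace ℝ (Fin d)) :
    ‖θ - η • g θ‖ ^ 2 ≤
      ‖θ‖ ^ 2 - 2 * η * (α * ‖θ‖ ^ 2 - β) + η ^ 2 * (L ^ 2 * (1 + ‖θ‖) ^ 2) := by
  rw [norm_sub_sq_real, inner_smul_right, norm_smul, mul_pow, Real.norm_eq_abs, sq_abs, ← mul_pow]
  have h1 : ‖g θ‖ ^ 2 ≤ (L * (1 + ‖θ‖)) ^ 2 := pow_le_pow_left₀ (norm_nonneg _) (hgrowth θ) 2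
  have h2 := mul_le_mul_of_nonneg_left h1 (sq_nonneg η)
  have h3 := mul_le_mul_of_nonneg_left (hdiss θ) hη
  linarith

/-- With `t = ‖θ‖`, the second-order terms are at most `ηα(1 + t)²`, and `2t ≤ t²/2 + 2` leaves half
of `ηαt²` as net decrease. The maximum with `0` keeps the rate nonnegative. -/
theorem hasDrift_sgdKernel (hg : Measurable g) {L α β Lξ : ℝ} (hgrowth : HasLinearGrowth L g)
    (hα : 0 < α) (hdiss : IsDissipative α β g) (hLξ : 0 ≤ Lξ)
    (hξ : IsGradientNoise P Lξ ξ) (hη : 0 < η) (hηα : η * (L ^ 2 + Lξ) ≤ α) :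
    HasDrift (sgdKernel P g ξ η) (fun θ => ‖θ‖ ^ 2) (max 0 (1 - η * α / 2))
      (2 * η * β + 3 * η * α) := by
  intro θ
  have hmeas := hξ.iid.measurable 0
  have hstep : Measurable fun ω => θ - η • (g θ + ξ 0 ω θ) :=
    ((hmeas.comp measurable_prodMk_right).const_add (g θ)).const_smul η |>.const_sub θ
  have hsq : AEStronglyMeasurable (fun x : EuclideanSpace ℝ (Fin d) => ‖x‖ ^ 2)
      (P.map fun ω => θ - η • (g θ + ξ 0 ω θ)) := by fun_prop
  rw [sgdKernel_apply P η hg hmeas, integrable_map_measure hsq hstep.aemeasurable,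
    integral_map hstep.aemeasurable hsq]
  have e : ∀ ω, θ - η • (g θ + ξ 0 ω θ) = (θ - η • g θ) - η • ξ 0 ω θ := fun ω => by
    rw [smul_add, sub_sub]
  simp only [Function.comp_def, e]
  obtain ⟨hi, hle⟩ := hξ.integral_norm_sub_sq_le (η := η) hLξ θ (θ - η • g θ)
  refine ⟨hi, hle.trans ?_⟩
  have h1 := hgrowth.norm_sub_smul_sq_le hdiss hη.le θ
  have h2 : η * (η * (L ^ 2 + Lξ)) * (1 + ‖θ‖) ^ 2 ≤ η * α * (1 + ‖θ‖) ^ 2 := by gcongr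
  have h3 : (1 - η * α / 2) * ‖θ‖ ^ 2 ≤ max 0 (1 - η * α / 2) * ‖θ‖ ^ 2 :=
    mul_le_mul_of_nonneg_right (le_max_right _ _) (by positivity)
  have h4 : 0 ≤ η * α * (‖θ‖ - 2) ^ 2 := by positivity
  linarith

theorem exists_minorization_sgdKernel (hg : Measurable g) {L Lξ : ℝ} (hL : 0 ≤ L)
    (hgrowth : HasLinearGrowth L g) (hξ : IsGradientNoise P Lξ ξ) (hη : 0 < η) (R : ℝ) :
    ∃ ν : Measure (EuclideanSpace ℝ (Fin d)), IsFiniteMeasure ν ∧ ν ≠ 0 ∧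
      ∀ θ, ‖θ‖ ^ 2 ≤ R → ν ≤ (sgdKernel P g ξ η ∘ₖ sgdKernel P g ξ η) θ := by
  have hmeas := hξ.iid.measurable 0
  have := isMarkovKernel_sgdKernel (P := P) (η := η) hg hmeas
  obtain ⟨p, μ₂, hpm, hlaw, hpos⟩ := hξ.density
  set s := |R| + 1 with hs
  have hs0 : 0 < s := by positivity
  set C := Metric.closedBall (0 : EuclideanSpace ℝ (Fin d)) s with hC
  have h0C : (0 : EuclideanSpace ℝ (Fin d)) ∈ C := Metric.mem_closedBall_self hs0.le
  have : Nonempty C := ⟨⟨0, h0C⟩⟩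
  obtain ⟨m, hm, hm1, hmp, hpm'⟩ := exists_measurable_ae_le_of_iInf_le
    (volume : Measure (EuclideanSpace ℝ (Fin d))) (fun θ : C => hpm θ)
  have hm0 : ∀ x, 0 < m x := fun x => by
    refine lt_of_lt_of_le (lt_min ?_ one_pos) (hpm' x)
    have := hpos C Metric.isBounded_closedBall x
    rwa [← iInf_subtype''] at this
  -- The Jacobian of the scaling by `η`, capped at `1` so that the density stays at most `1`.
  set k : ENNReal := min (ENNReal.ofReal
    (η ^ Module.finrank ℝ (EuclideanSpace ℝ (Fin d))))⁻¹ 1 with hk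
  have hk0 : k ≠ 0 := (lt_min (ENNReal.inv_pos.2 ENNReal.ofReal_ne_top) one_pos).ne'
  set h := fun θ => θ - η • g θ with hh
  have hhm : Measurable h := measurable_id.sub (hg.const_smul η)
  have hK : ∀ θ ∈ C, volume.withDensity (fun z => k * m (η⁻¹ • (h θ - z))) ≤
      sgdKernel P g ξ η θ := fun θ hθ => by
    refine (withDensity_sub_le_map_sub_smul hm hη (h θ)).trans ?_
    have hξθ : Measurable fun ω => ξ 0 ω θ := hmeas.comp measurable_prodMk_right
    have hmap : Measurable fun t : EuclideanSpace ℝ (Fin d) => h θ - η • t := by fun_prop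
    have e : sgdKernel P g ξ η θ = (P.map fun ω => ξ 0 ω θ).map fun t => h θ - η • t := by
      rw [Measure.map_map hmap hξθ, sgdKernel_apply P η hg hmeas]
      refine congrArg (P.map ·) (funext fun ω => ?_)
      simp only [hh, Function.comp_apply, smul_add, sub_sub]
    rw [e, hlaw θ]
    refine Measure.map_mono ?_ hmap
    exact (withDensity_mono (hmp ⟨θ, hθ⟩)).trans (Measure.le_add_right le_rfl)
  -- Finite mass comes for free: a reflected translate is dominated by the probability measure
  -- `sgdKernel P g ξ η 0`.
  have hqi : ∫⁻ u, k * m (η⁻¹ • u) ≠ ⊤ := by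
    rw [← lintegral_sub_left_eq_self _ (h 0)]
    have := hK 0 h0C Set.univ
    rw [withDensity_apply _ .univ, Measure.restrict_univ, measure_univ] at this
    exact (this.trans_lt ENNReal.one_lt_top).ne
  obtain ⟨ν, hν, hν0, hνK⟩ := exists_minorization_comp_of_translate_le (μ := volume)
    (K := sgdKernel P g ξ η) hhm (q := fun u => k * m (η⁻¹ • u)) (by fun_prop)
    (fun x => mul_le_one' (min_le_right _ _) (hm1 _))
    (fun x => ENNReal.mul_pos hk0 (hm0 _).ne') hqi Metric.isClosed_closedBall.measurableSet
    (Metric.measure_closedBall_pos volume 0 hs0) (ρ := s + η * (L * (1 + s)) + 1) (by positivity)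
    (fun θ hθ => by
      have hθ' : ‖θ‖ ≤ s := by simpa [hC] using hθ
      have h1 : ‖g θ‖ ≤ L * (1 + s) := (hgrowth θ).trans (by gcongr)
      have h2 : ‖h θ‖ ≤ ‖θ‖ + η * ‖g θ‖ := (norm_sub_le _ _).trans (by
        rw [norm_smul, Real.norm_of_nonneg hη.le])
      have h3 := mul_le_mul_of_nonneg_left h1 hη.le
      rw [mem_ball_zero_iff]
      linarith) hK
  refine ⟨ν, hν, hν0, fun θ hθ => hνK θ ?_⟩
  rw [mem_closedBall_zero_iff]
  by_contra! hlt
  nlinarith [le_abs_self R, abs_nonneg R]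

end SGD

/-- Dropping the square root already gives `η b < α`, which is all the drift needs. -/
theorem mul_le_of_lt_smaller_root {η α a b : ℝ} (hη : 0 < η) (ha : a ≤ b) (hb : 0 < b)
    (h : η < (α - √(max (α ^ 2 - b) 0)) / b) : η * a ≤ α := by
  rw [lt_div_iff₀ hb] at h
  have := Real.sqrt_nonneg (max (α ^ 2 - b) 0)
  nlinarith [mul_le_mul_of_nonneg_left ha hη.le]

theorem proposition1 {Ω : Type*} [MeasurableSpace Ω] (P : Measure Ω) [IsProbabilityMeasure P]
    (d : ℕ) (f : EuclideanSpace ℝ (Fin d) → ℝ)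
    (g : EuclideanSpace ℝ (Fin d) → EuclideanSpace ℝ (Fin d)) (hg : IsGradientField f g)
    (L : ℝ) (hL : 0 ≤ L) (hgrowth : HasLinearGrowth L g)
    (α β : ℝ) (hα : 0 < α) (hβ : 0 < β) (hdiss : IsDissipative α β g)
    (ξ : ℕ → Ω → EuclideanSpace ℝ (Fin d) → EuclideanSpace ℝ (Fin d))
    (Lξ : ℝ) (hLξ : 0 < Lξ) (hξ : IsGradientNoise P Lξ ξ)
    (η : ℝ) (hη : 0 < η)
    (hη' : η < (α - √(max (α ^ 2 - (3 * L ^ 2 + Lξ)) 0)) / (3 * L ^ 2 + Lξ)) :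
    ∃ π : Measure (EuclideanSpace ℝ (Fin d)),
      IsProbabilityMeasure π ∧ Integrable (fun θ => ‖θ‖ ^ 2) π ∧
      (sgdKernel P g ξ η).Invariant π ∧
      (∀ ν : Measure (EuclideanSpace ℝ (Fin d)), IsProbabilityMeasure ν →
        (sgdKernel P g ξ η).Invariant ν → ν = π) ∧
      ∃ ρ : ℝ, 0 < ρ ∧ ρ < 1 ∧ ∀ Lφ : ℝ, 0 < Lφ → ∃ κ : ℝ,
        ∀ φ : EuclideanSpace ℝ (Fin d) → ℝ, Measurable φ → (∀ θ, |φ θ| ≤ Lφ * (1 + ‖θ‖)) →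
          Integrable φ π ∧
          ∀ (θ₀ : EuclideanSpace ℝ (Fin d)) (k : ℕ),
            Integrable (fun ω => φ (sgdIterate g ξ η θ₀ k ω)) P ∧
            |∫ ω, φ (sgdIterate g ξ η θ₀ k ω) ∂P - ∫ θ, φ θ ∂π| ≤ κ * ρ ^ k * (1 + ‖θ₀‖ ^ 2) := by
  have hmeas := hξ.iid.measurable 0
  have hKm := isMarkovKernel_sgdKernel (P := P) (η := η) hg.measurable hmeas
  have hηα : η * (L ^ 2 + Lξ) ≤ α :=
    mul_le_of_lt_smaller_root hη (by nlinarith [sq_nonneg L]) (by positivity) hη'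
  have hdrift := hasDrift_sgdKernel hg.measurable hgrowth hα hdiss hLξ.le hξ hη hηα
  obtain ⟨π, hπP, hπV, hπK, huniq, r, hr0, hr1, M, hM⟩ :=
    exists_invariant_of_drift_of_minorization (by fun_prop) (fun θ => by positivity)
      (le_max_left _ _) (max_lt one_pos (by have := mul_pos hη hα; linarith)) (by positivity)
      hdrift (exists_minorization_sgdKernel hg.measurable hL hgrowth hξ hη)
  -- The factor `2` comes from `1 + t ≤ 2(1 + t²)`.
  refine ⟨π, hπP, hπV, hπK, huniq, r, hr0, hr1, fun Lφ hLφ => ⟨2 * Lφ * M, fun φ hφ hbound => ?_⟩⟩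
  obtain ⟨hi, hconv⟩ := hM (2 * Lφ) φ (by positivity) hφ fun θ => (hbound θ).trans (by
    nlinarith [sq_nonneg (‖θ‖ - 1), sq_nonneg ‖θ‖])
  refine ⟨hi, fun θ₀ k => ?_⟩
  obtain ⟨hm, hlaw⟩ := hξ.iid.map_sgdIterate (η := η) hg.measurable θ₀ k
  obtain ⟨hik, hle⟩ := hconv θ₀ k
  rw [← hlaw] at hik hle
  rw [integral_map hm.aemeasurable hφ.aestronglyMeasurable] at hle
  exact ⟨hik.comp_measurable hm, hle⟩
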